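/- Let $L\ge 0$, $\Delta,G\in\mathbb R$, $\sigma_0>0$, $\theta_1>1$, $\theta_2>1$ and an integer $m\ge 1$ be given. There is a constant $C>0$, depending only on $L,\Delta,G,\sigma_0,\theta_1,\theta_2,m$ (in particular not on the dimension $n$ and not on $\epsilon_1,\epsilon_2$), such that the following holds for every $n\ge 1$, every twice continuously differentiable $f:\mathbb R^n\to\mathbb R$ that is bounded below by some $f_{\rm low}$ and whose Hessian is globally $L$-Lipschitz in the operator norm, every $x_0\in\mathbb R^n$ with $f(x_0)-f_{\rm low}\le\Delta$ and $\|\nabla f(x_0)\|\le G$, and all $\epsilon_1,\epsilon_2\in(0,1]$. Call $x$ an $(\epsilon_1,\epsilon_2)$ second-order stationary point if $\|\nabla f(x)\|\le\epsilon_1$ and $\lambda_{\min}(\nabla^2 f(x))\ge-\epsilon_2$. Consider the method AR2 that starts from $x_0,\sigma_0$ and, for $k=0,1,2,\dots$, for as long as none of $x_0,\dots,x_k$ is such a point, computes a symmetric matrix $B_k$ (rules below), then any step $s_k$ such that, with $\overline T_k(s)=f(x_k)+\nabla f(x_k)^\intercal s+\frac12 s^\intercal B_k s$ and $m_k(s)=\overline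 T_k(s)+\frac{\sigma_k}{6}\|s\|^3$, $$m_k(s_k)\le m_k(0),\qquad \|\nabla_s\overline T_k(s_k)\|\le\tfrac12\theta_1\sigma_k\|s_k\|^2,\qquad \max[0,-\lambda_{\min}(\nabla_s^2\overline T_k(s_k))]\le\theta_2\sigma_k\|s_k\|,$$ and sets $x_{k+1}=x_k+s_k$, $\sigma_{k+1}=\sigma_k+\sigma_k\|s_k\|^3$. If $m\nmid k$, then $B_k$ is the PSB update of $B_{k-1}$, that is, the minimizer of $\|B-B_{k-1}\|_F$ over the symmetric $B$ with $Bs_{k-1}=\nabla f(x_k)-\nabla f(x_{k-1})$. If $m\mid k$, then $B_k$ is recomputed in one of two ways. (1) Exact restart: $B_k=\nabla^2 f(x_k)$. Then every run of the method produces an $(\epsilon_1,\epsilon_2)$ second-order stationary point after at most $C\max[\epsilon_1^{-3/2},\epsilon_2^{-3}]$ evaluations of the gradient and at most $C\max[\epsilon_1^{-3/2},\epsilon_2^{-3}]$ evaluations of the Hessian. (2) Finite-difference restart: with the convention $\|s_j\|=1$ for $j<0$, $$h_k=\frac{\min\left(\sum_{i=1}^m\|s_{k-i}\|,1\right)}{\sqrt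 n},\qquad A_k=\sum_{i=1}^n\frac{\nabla f(x_k+h_ke_i)-\nabla f(x_k)}{h_k}\,e_i^\intercal,\qquad B_k=\tfrac12(A_k+A_k^\intercal).$$ Then every run in which the quotients are defined, i.e. $h_k>0$ at each restart made before such a point is found, produces an $(\epsilon_1,\epsilon_2)$ second-order stationary point after at most $C\,n\max[\epsilon_1^{-3/2},\epsilon_2^{-3}]$ evaluations of the gradient. No bound on the matrices $B_k$ is assumed. -/

import Mathlib

open scoped NNReal

noncomputable section

namespace AR2PSB

/-- `ℝⁿ` with the Euclidean norm. -/
abbrev E (n : ℕ) : Type := EuclideanSpace ℝ (Fin n)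

/-- Second-order tensors (matrices) on `ℝⁿ`, as operators with the operator norm; the bilinear map
of the tensor is `(u, v) ↦ ⟪u, A v⟫`. -/
abbrev Op (n : ℕ) : Type := E n →L[ℝ] E n

/-- The canonical basis vector `eᵢ`. -/
def basisVec {n : ℕ} (i : Fin n) : E n := EuclideanSpace.single i 1

/-- The Hessian `∇²f(x)`: the derivative of the gradient. -/
def hess {n : ℕ} (f : E n → ℝ) (x : E n) : Op n := fderiv ℝ (gradient f) x

/-- The leftmost (real) eigenvalue; used for symmetric operators on `ℝⁿ`, `n ≥ 1`. -/
def lambdaMin {n : ℕ} (A : Op n) : ℝ :=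
  sInf {μ : ℝ | Module.End.HasEigenvalue (A : E n →ₗ[ℝ] E n) μ}

/-- The Frobenius norm, from the entries `⟪eᵢ, A eⱼ⟫`. -/
def frobNorm {n : ℕ} (A : Op n) : ℝ :=
  Real.sqrt (∑ i : Fin n, ∑ j : Fin n, (inner ℝ (basisVec i) (A (basisVec j))) ^ 2)

/-- The projection onto symmetric operators, `(A + Aᵀ) / 2`. -/
def symPart {n : ℕ} (A : Op n) : Op n := (1 / 2 : ℝ) • (A + ContinuousLinearMap.adjoint A)

/-- `(ε₁, ε₂)` second-order stationarity. -/
def IsStationary {n : ℕ} (f : E n → ℝ) (ε₁ ε₂ : ℝ) (x : E n) : Prop :=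
  ‖gradient f x‖ ≤ ε₁ ∧ -ε₂ ≤ lambdaMin (hess f x)

/-- The inexact second-order Taylor polynomial, with `B` in place of the Hessian. -/
def approxTaylor {n : ℕ} (f : E n → ℝ) (x : E n) (B : Op n) (s : E n) : ℝ :=
  f x + inner ℝ (gradient f x) s + (1 / 2) * inner ℝ s (B s)

/-- The cubically regularized model. -/
def model {n : ℕ} (f : E n → ℝ) (x : E n) (B : Op n) (σ : ℝ) (s : E n) : ℝ :=
  approxTaylor f x B s + σ / 6 * ‖s‖ ^ 3

/-- The three requirements on a trial step: model decrease, approximate first-order optimality,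
and the bound on negative curvature. -/
def IsAcceptableStep {n : ℕ} (f : E n → ℝ) (θ₁ θ₂ : ℝ) (x : E n) (B : Op n) (σ : ℝ) (s : E n) :
    Prop :=
  model f x B σ s - model f x B σ 0 ≤ 0 ∧
  ‖gradient (approxTaylor f x B) s‖ ≤ θ₁ * σ * ‖s‖ ^ 2 / 2 ∧
  max 0 (-lambdaMin (hess (approxTaylor f x B) s)) ≤ θ₂ * σ * ‖s‖

/-- `B'` is the PSB update of `B` for the secant pair `(s, y)`: among the symmetric `T` with
`T s = y` it minimizes the Frobenius distance to `B`. -/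
def IsPSBUpdate {n : ℕ} (B : Op n) (s y : E n) (B' : Op n) : Prop :=
  B' ∈ {T : Op n | IsSelfAdjoint T ∧ T s = y} ∧
  IsMinOn (fun T : Op n => frobNorm (T - B)) {T : Op n | IsSelfAdjoint T ∧ T s = y} B'

/-- The sequences produced by the method: iterates, steps, regularization parameters, and Hessian
approximations. -/
structure Sequences (n : ℕ) where
  x : ℕ → E n
  s : ℕ → E n
  σ : ℕ → ℝ
  B : ℕ → Op n

/-- The length of the step of index `j`, with the convention that it is `1` for `j < 0`. -/
def stepLen {n : ℕ} (R : Sequences n) (j : ℤ) : ℝ := if 0 ≤ j then ‖R.s j.toNat‖ else 1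

/-- The finite-difference stepsize `h_k`. -/
def fdStep {n : ℕ} (m : ℕ) (R : Sequences n) (k : ℕ) : ℝ :=
  min (∑ i ∈ Finset.Icc 1 m, stepLen R ((k : ℤ) - (i : ℤ))) 1 / Real.sqrt n

/-- The finite-difference operator `∑ᵢ ((∇f(x + h eᵢ) - ∇f(x)) / h) ⊗ eᵢ`. -/
def fdHess {n : ℕ} (f : E n → ℝ) (x : E n) (h : ℝ) : Op n :=
  ∑ i : Fin n, (innerSL ℝ (basisVec i)).smulRight
    (h⁻¹ • (gradient f (x + h • basisVec i) - gradient f x))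

/-- `B_k` is obtained from `B_{k-1}` by the PSB update along the last step. -/
def PSBAt {n : ℕ} (f : E n → ℝ) (R : Sequences n) (k : ℕ) : Prop :=
  IsPSBUpdate (R.B (k - 1)) (R.s (k - 1))
    (gradient f (R.x k) - gradient f (R.x (k - 1))) (R.B k)

/-- The choice of `B_k` with exact restarts: the true Hessian if `m ∣ k`, the PSB update if not. -/
def LazyTensor {n : ℕ} (f : E n → ℝ) (m : ℕ) (R : Sequences n) (k : ℕ) : Prop :=
  if k % m = 0 then R.B k = hess f (R.x k) else PSBAt f R k

/-- The choice of `B_k` with finite-difference restarts. Positivity of `h_k` says that the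
difference quotients are defined. -/
def FDTensor {n : ℕ} (f : E n → ℝ) (m : ℕ) (R : Sequences n) (k : ℕ) : Prop :=
  if k % m = 0 then
    0 < fdStep m R k ∧ R.B k = symPart (fdHess f (R.x k) (fdStep m R k))
  else PSBAt f R k

/-- The part of iteration `k` after the computation of `B_k`: an acceptable step is computed,
and the iterate and the regularization parameter are updated. -/
def Advances {n : ℕ} (f : E n → ℝ) (θ₁ θ₂ : ℝ) (R : Sequences n) (k : ℕ) : Prop :=
  IsAcceptableStep f θ₁ θ₂ (R.x k) (R.B k) (R.σ k) (R.s k) ∧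
  R.x (k + 1) = R.x k + R.s k ∧
  R.σ (k + 1) = R.σ k + R.σ k * ‖R.s k‖ ^ 3

/-- `R` is a run of the method, with `tensor k` the rule for `B_k`, from `x₀` and `σ₀`: iterations
are carried out for as long as no `(ε₁, ε₂)` stationary iterate has been met. Nothing is required
of `R` after that, so that never-ending runs are covered, and so are runs that cannot continue
once such a point is found. -/
def IsRun {n : ℕ} (f : E n → ℝ) (θ₁ θ₂ σ₀ : ℝ) (x₀ : E n) (ε₁ ε₂ : ℝ) (R : Sequences n)
    (tensor : ℕ → Prop) : Prop :=
  R.x 0 = x₀ ∧ R.σ 0 = σ₀ ∧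
  ∀ k : ℕ, (∀ j ≤ k, ¬ IsStationary f ε₁ ε₂ (R.x j)) → tensor k ∧ Advances f θ₁ θ₂ R k

/-- Run of the variant with exact Hessian restarts. -/
def IsLazyRun {n : ℕ} (f : E n → ℝ) (m : ℕ) (θ₁ θ₂ σ₀ : ℝ) (x₀ : E n) (ε₁ ε₂ : ℝ)
    (R : Sequences n) : Prop :=
  IsRun f θ₁ θ₂ σ₀ x₀ ε₁ ε₂ R (LazyTensor f m R)

/-- Run of the variant with finite-difference restarts. -/
def IsFDRun {n : ℕ} (f : E n → ℝ) (m : ℕ) (θ₁ θ₂ σ₀ : ℝ) (x₀ : E n) (ε₁ ε₂ : ℝ)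
    (R : Sequences n) : Prop :=
  IsRun f θ₁ θ₂ σ₀ x₀ ε₁ ε₂ R (FDTensor f m R)

/-- The points at which iteration `k` evaluates the gradient, with exact restarts (the secant
condition reuses the gradient of the previous iteration). -/
def lazyGradQueries {n : ℕ} (R : Sequences n) (k : ℕ) : List (E n) := [R.x k]

/-- The points at which iteration `k` evaluates the Hessian, with exact restarts. -/
def lazyHessQueries {n : ℕ} (m : ℕ) (R : Sequences n) (k : ℕ) : List (E n) :=
  if k % m = 0 then [R.x k] else []

/-- The points at which iteration `k` evaluates the gradient, with finite-difference restarts. -/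
def fdGradQueries {n : ℕ} (m : ℕ) (R : Sequences n) (k : ℕ) : List (E n) :=
  R.x k :: (if k % m = 0 then List.ofFn (fun i : Fin n => R.x k + fdStep m R k • basisVec i)
    else [])

/-- The total number of evaluations in iterations `0, …, j`. -/
def evalCount {n : ℕ} (queries : ℕ → List (E n)) (j : ℕ) : ℕ :=
  ∑ k ∈ Finset.range (j + 1), (queries k).length

end AR2PSB

end

/-!
The gradient difference `∇f(x + s) - ∇f(x)` equals `H s`, where `H` is the average of the Hessian
over the segment from `x` to `x + s`. A PSB update `B'` of a symmetric `B` satisfies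
`B' - H = P (B - H) P` with `P` the orthogonal projection onto `sᗮ`, so an update does not increase
the distance to `H` in the operator norm, and the distance to the current Hessian grows by at most
`L ‖s‖`. With a restart every `m` iterations, the error of `B_k` is therefore at most `L` times the
sum of the lengths of the `2 m` preceding steps, whatever the size of `B_k` itself.

The cubes of these sums add up to at most a constant times `1 + ∑ ‖s_k‖³`, whereas the model
decrease is at least `∑ σ_k ‖s_k‖³ / 6 = (σ_N - σ₀) / 6`. Once `σ_k` exceeds a fixed threshold, the
decrease outweighs all errors; as `f` is bounded below, this bounds `σ_k`, and with it `∑ ‖s_k‖³`.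
The one step that crosses the threshold is controlled separately: negative curvature is limited
because `f` is bounded below, so `σ_k ‖s_k‖` is bounded by quantities known before the step.
Finally, at every iterate that is not stationary the sum of the last `2 m + 1` step lengths is at
least a constant times `min (ε₁^(1/2)) ε₂`, and its cubes have a bounded sum.
-/

noncomputable section

namespace AR2PSB

variable {n : ℕ}

/-! ### The Frobenius norm and the PSB update -/

lemma frobNorm_sq (A : Op n) : frobNorm A ^ 2 = ∑ j, ‖A (basisVec j)‖ ^ 2 := by
  rw [frobNorm, Real.sq_sqrt (by positivity), Finset.sum_comm]
  refine Finset.sum_congr rfl fun j _ => ?_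
  rw [← (EuclideanSpace.basisFun (Fin n) ℝ).sum_sq_norm_inner_right (A (basisVec j))]
  simp [basisVec]

lemma frobNorm_add_sq {Z : Op n} (hZ : IsSelfAdjoint Z) (M : Op n) :
    frobNorm (Z + M) ^ 2 =
      frobNorm Z ^ 2 + 2 * LinearMap.trace ℝ (E n) (Z * M : Op n) + frobNorm M ^ 2 := by
  rw [LinearMap.trace_eq_sum_inner _ (EuclideanSpace.basisFun (Fin n) ℝ)]
  simp only [frobNorm_sq, Finset.mul_sum, ← Finset.sum_add_distrib]
  refine Finset.sum_congr rfl fun j _ => ?_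
  have hsymm : inner ℝ (Z (basisVec j)) (M (basisVec j)) =
      inner ℝ (basisVec j) (Z (M (basisVec j))) :=
    ContinuousLinearMap.isSelfAdjoint_iff_isSymmetric.1 hZ _ _
  rw [add_apply, norm_add_sq_real, hsymm]
  simp [basisVec]

lemma eq_zero_of_frobNorm_sq_nonpos {A : Op n} (hA : frobNorm A ^ 2 ≤ 0) : A = 0 := by
  rw [frobNorm_sq] at hA
  have hcol : ∀ j ∈ Finset.univ, ‖A (basisVec j)‖ ^ 2 = 0 :=
    (Finset.sum_eq_zero_iff_of_nonneg fun _ _ => sq_nonneg _).1 (hA.antisymm (by positivity))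
  refine ContinuousLinearMap.coe_injective
    ((EuclideanSpace.basisFun (Fin n) ℝ).toBasis.ext fun j => ?_)
  simpa [basisVec] using hcol j (Finset.mem_univ j)

lemma IsPSBUpdate.eq_of_trace_mul_sub_eq_zero {B B' T : Op n} {s y : E n}
    (h : IsPSBUpdate B s y B') (hT : IsSelfAdjoint T) (hTs : T s = y)
    (horth : LinearMap.trace ℝ (E n) ((B' - T) * (T - B) : Op n) = 0) : B' = T := by
  obtain ⟨⟨hB', -⟩, hmin⟩ := h
  have hle : frobNorm (B' - B) ≤ frobNorm (T - B) := hmin ⟨hT, hTs⟩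
  have hsq : frobNorm (B' - B) ^ 2 ≤ frobNorm (T - B) ^ 2 :=
    pow_le_pow_left₀ (Real.sqrt_nonneg _) hle 2
  have hpythagoras := frobNorm_add_sq (IsSelfAdjoint.sub (R := Op n) hB' hT) (T - B)
  rw [sub_add_sub_cancel, horth] at hpythagoras
  exact sub_eq_zero.1 (eq_zero_of_frobNorm_sq_nonpos (by linarith))

lemma mul_starProjection_orthogonal_span_singleton {𝕜 V : Type*} [RCLike 𝕜]
    [NormedAddCommGroup V] [InnerProductSpace 𝕜 V] {Z : V →L[𝕜] V} {s : V} (hZ : Z s = 0) :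
    Z * (𝕜 ∙ s)ᗮ.starProjection = Z := by
  ext v
  obtain ⟨c, hc⟩ := Submodule.mem_span_singleton.1 ((𝕜 ∙ s).starProjection_apply_mem v)
  simp [Submodule.starProjection_orthogonal', ← hc, hZ]

lemma trace_mul_conj_sub_self_eq_zero {R M : Type*} [CommRing R] [AddCommGroup M] [Module R M]
    {Z Q : Module.End R M} (hZQ : Z * Q = Z) (hQZ : Q * Z = Z) (D : Module.End R M) :
    LinearMap.trace R M (Z * (Q * D * Q - D)) = 0 := by
  rw [mul_sub, map_sub, ← mul_assoc, ← mul_assoc, hZQ, LinearMap.trace_mul_comm, ← mul_assoc, hQZ,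
    sub_self]

lemma IsPSBUpdate.sub_eq {B B' H : Op n} {s y : E n} (h : IsPSBUpdate B s y B')
    (hB : IsSelfAdjoint B) (hH : IsSelfAdjoint H) (hHs : H s = y) :
    B' - H = (ℝ ∙ s)ᗮ.starProjection * (B - H) * (ℝ ∙ s)ᗮ.starProjection := by
  set Q : Op n := (ℝ ∙ s)ᗮ.starProjection
  have hQsa : IsSelfAdjoint Q := isSelfAdjoint_starProjection _
  have hQs : Q s = 0 := (Submodule.starProjection_apply_eq_zero_iff _).2
    (Submodule.le_orthogonal_orthogonal _ (Submodule.mem_span_singleton_self s))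
  set T : Op n := H + Q * (B - H) * Q with hT
  have hBH : IsSelfAdjoint (B - H) := IsSelfAdjoint.sub (R := Op n) hB hH
  have hTsa : IsSelfAdjoint T := IsSelfAdjoint.add (R := Op n) hH (hBH.conjugate_self hQsa)
  have hTs : T s = y := by simp [hT, hQs, hHs]
  have hZ : IsSelfAdjoint (B' - T) := IsSelfAdjoint.sub (R := Op n) h.1.1 hTsa
  have hZQ : (B' - T) * Q = B' - T :=
    mul_starProjection_orthogonal_span_singleton (by simp [h.1.2, hTs])
  have hQZ : Q * (B' - T) = B' - T := by
    simpa only [star_mul, hZ.star_eq, hQsa.star_eq] using congrArg star hZQ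
  have hTB : T - B = Q * (B - H) * Q - (B - H) := by rw [hT]; abel
  have horth : LinearMap.trace ℝ (E n) ((B' - T) * (T - B) : Op n) = 0 := by
    rw [hTB]
    exact trace_mul_conj_sub_self_eq_zero (congrArg ContinuousLinearMap.toLinearMap hZQ)
      (congrArg ContinuousLinearMap.toLinearMap hQZ) _
  rw [h.eq_of_trace_mul_sub_eq_zero hTsa hTs horth, hT, add_sub_cancel_left]

lemma IsPSBUpdate.norm_sub_le {B B' H : Op n} {s y : E n} (h : IsPSBUpdate B s y B')
    (hB : IsSelfAdjoint B) (hH : IsSelfAdjoint H) (hHs : H s = y) : ‖B' - H‖ ≤ ‖B - H‖ := by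
  rw [h.sub_eq hB hH hHs]
  set Q : Op n := (ℝ ∙ s)ᗮ.starProjection
  have hQ : ‖Q‖ ≤ 1 := Submodule.starProjection_norm_le _
  calc ‖Q * (B - H) * Q‖ ≤ ‖Q‖ * ‖B - H‖ * ‖Q‖ :=
        (norm_mul_le _ _).trans (by gcongr; exact norm_mul_le _ _)
    _ ≤ 1 * ‖B - H‖ * 1 := by gcongr
    _ = ‖B - H‖ := by ring

/-! ### The leftmost eigenvalue -/

lemma lambdaMin_mul_sq_le {A : Op n} (hA : IsSelfAdjoint A) (u : E n) :
    lambdaMin A * ‖u‖ ^ 2 ≤ inner ℝ u (A u) := by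
  rcases eq_or_ne u 0 with rfl | hu
  · simp
  have : Nontrivial (E n) := ⟨u, 0, hu⟩
  set rayleigh : {v : E n // v ≠ 0} → ℝ := fun v => A.rayleighQuotient v
  have hbdd : BddBelow (Set.range rayleigh) :=
    ⟨-‖A‖, by rintro _ ⟨v, rfl⟩; exact (abs_le.1 (A.rayleighQuotient_le_norm v)).1⟩
  have heigen : Module.End.HasEigenvalue (A : E n →ₗ[ℝ] E n) (⨅ v, rayleigh v) :=
    (ContinuousLinearMap.isSelfAdjoint_iff_isSymmetric.1 hA).hasEigenvalue_iInf_of_finiteDimensional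
  have hle : lambdaMin A ≤ A.rayleighQuotient u :=
    (csInf_le (Module.End.finite_hasEigenvalue _).bddBelow heigen).trans
      (ciInf_le hbdd ⟨u, hu⟩)
  rw [real_inner_comm]
  exact (le_div_iff₀ (by positivity)).1 hle

lemma le_lambdaMin {A : Op n} {c : ℝ} (hc : c ≤ 0)
    (h : ∀ u : E n, c * ‖u‖ ^ 2 ≤ inner ℝ u (A u)) : c ≤ lambdaMin A := by
  refine Real.le_sInf (fun μ hμ => ?_) hc
  obtain ⟨v, hv⟩ := Module.End.HasEigenvalue.exists_hasEigenvector hμ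
  have hAv : A v = μ • v := hv.apply_eq_smul
  have hcv : c * ‖v‖ ^ 2 ≤ μ * ‖v‖ ^ 2 := by
    simpa only [hAv, real_inner_smul_right, real_inner_self_eq_norm_sq] using h v
  exact le_of_mul_le_mul_right hcv (pow_pos (norm_pos_iff.2 hv.2) 2)

/-! ### Maps with a Lipschitz derivative -/

section AveragedDerivative

variable {V W : Type*} [NormedAddCommGroup V] [NormedSpace ℝ V] [NormedAddCommGroup W]
  [NormedSpace ℝ W] {g : V → W} {L : ℝ≥0}

/-- The derivative of `g` averaged over the segment from `x` to `x + s`. For a gradient `g` it is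
a symmetric operator that satisfies the secant condition along `s` exactly. -/
def avgFDeriv (g : V → W) (x s : V) : V →L[ℝ] W := ∫ t in (0 : ℝ)..1, fderiv ℝ g (x + t • s)

lemma hasDerivAt_add_smul (x s : V) (t : ℝ) : HasDerivAt (fun r : ℝ => x + r • s) s t := by
  simpa using ((hasDerivAt_id t).smul_const s).const_add x

lemma hasDerivAt_comp_add_smul (hg : Differentiable ℝ g) (x s : V) (t : ℝ) :
    HasDerivAt (fun r : ℝ => g (x + r • s)) (fderiv ℝ g (x + t • s) s) t :=
  (hg _).hasFDerivAt.comp_hasDerivAt t (hasDerivAt_add_smul x s t)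

lemma continuous_fderiv_add_smul (hL : LipschitzWith L (fderiv ℝ g)) (x s : V) :
    Continuous fun t : ℝ => fderiv ℝ g (x + t • s) :=
  hL.continuous.comp (by fun_prop)

lemma avgFDeriv_apply_self [CompleteSpace W] (hg : Differentiable ℝ g)
    (hL : LipschitzWith L (fderiv ℝ g)) (x s : V) : avgFDeriv g x s s = g (x + s) - g x := by
  have hcont := continuous_fderiv_add_smul hL x s
  rw [avgFDeriv, ContinuousLinearMap.intervalIntegral_apply (hcont.intervalIntegrable _ _),
    intervalIntegral.integral_eq_sub_of_hasDerivAt (fun t _ => hasDerivAt_comp_add_smul hg x s t)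
      ((hcont.clm_apply continuous_const).intervalIntegrable _ _), one_smul, zero_smul, add_zero]

lemma avgFDeriv_add_neg (g : V → W) (x s : V) : avgFDeriv g (x + s) (-s) = avgFDeriv g x s := by
  have hreverse := intervalIntegral.integral_comp_sub_left (a := (0 : ℝ)) (b := 1)
    (fun t : ℝ => fderiv ℝ g (x + t • s)) 1
  rw [sub_self, sub_zero] at hreverse
  rw [avgFDeriv, avgFDeriv, ← hreverse]
  refine intervalIntegral.integral_congr fun t _ => ?_
  have hpoint : x + s + t • -s = x + (1 - t) • s := by module
  simp only [hpoint]

lemma norm_avgFDeriv_sub_fderiv_left_le [CompleteSpace W] (hL : LipschitzWith L (fderiv ℝ g))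
    (x s : V) : ‖avgFDeriv g x s - fderiv ℝ g x‖ ≤ L / 2 * ‖s‖ := by
  have hsub : avgFDeriv g x s - fderiv ℝ g x =
      ∫ t in (0 : ℝ)..1, (fderiv ℝ g (x + t • s) - fderiv ℝ g x) := by
    rw [intervalIntegral.integral_sub
      ((continuous_fderiv_add_smul hL x s).intervalIntegrable _ _)
      (continuous_const.intervalIntegrable _ _)]
    simp [avgFDeriv]
  have hpoint : ∀ t ∈ Set.Ioc (0 : ℝ) 1,
      ‖fderiv ℝ g (x + t • s) - fderiv ℝ g x‖ ≤ L * ‖s‖ * t := fun t ht => by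
    simpa [norm_smul, abs_of_pos ht.1, mul_assoc, mul_comm t] using hL.norm_sub_le (x + t • s) x
  calc ‖avgFDeriv g x s - fderiv ℝ g x‖ ≤ ∫ t in (0 : ℝ)..1, L * ‖s‖ * t := by
        rw [hsub]
        exact intervalIntegral.norm_integral_le_of_norm_le zero_le_one (.of_forall hpoint)
          ((continuous_const.mul continuous_id).intervalIntegrable _ _)
    _ = L / 2 * ‖s‖ := by
        rw [intervalIntegral.integral_const_mul, integral_id]
        ring

lemma norm_avgFDeriv_sub_fderiv_right_le [CompleteSpace W] (hL : LipschitzWith L (fderiv ℝ g))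
    (x s : V) : ‖avgFDeriv g x s - fderiv ℝ g (x + s)‖ ≤ L / 2 * ‖s‖ := by
  simpa only [avgFDeriv_add_neg, norm_neg] using norm_avgFDeriv_sub_fderiv_left_le hL (x + s) (-s)

lemma norm_add_sub_sub_fderiv_le [CompleteSpace W] (hg : Differentiable ℝ g)
    (hL : LipschitzWith L (fderiv ℝ g)) (x s : V) :
    ‖g (x + s) - g x - fderiv ℝ g x s‖ ≤ L / 2 * ‖s‖ ^ 2 := by
  rw [← avgFDeriv_apply_self hg hL, ← sub_apply]
  calc ‖(avgFDeriv g x s - fderiv ℝ g x) s‖ ≤ ‖avgFDeriv g x s - fderiv ℝ g x‖ * ‖s‖ :=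
        ContinuousLinearMap.le_opNorm _ _
    _ ≤ L / 2 * ‖s‖ * ‖s‖ := by gcongr; exact norm_avgFDeriv_sub_fderiv_left_le hL x s
    _ = L / 2 * ‖s‖ ^ 2 := by ring

end AveragedDerivative

section Gradient

lemma isSelfAdjoint_intervalIntegral {A : Type*} [NormedAddCommGroup A] [NormedSpace ℝ A]
    [StarAddMonoid A] [ContinuousStar A] [StarModule ℝ A] {F : ℝ → A}
    (hF : ∀ t, IsSelfAdjoint (F t)) (a b : ℝ) : IsSelfAdjoint (∫ t in a..b, F t) := by
  have hset (S : Set ℝ) : IsSelfAdjoint (∫ t in S, F t) := by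
    have hcomm := (starL' ℝ : A ≃L[ℝ] A).integral_comp_comm (μ := MeasureTheory.volume.restrict S) F
    simpa [IsSelfAdjoint, (hF _).star_eq] using hcomm.symm
  exact (hset _).sub (hset _)

variable {V : Type*} [NormedAddCommGroup V] [InnerProductSpace ℝ V] [CompleteSpace V]
  {f : V → ℝ} {L : ℝ≥0}

lemma differentiable_gradient (hf : ContDiff ℝ 2 f) : Differentiable ℝ (gradient f) :=
  (InnerProductSpace.toDual ℝ V).symm.toContinuousLinearEquiv.differentiable.comp
    ((hf.fderiv_right (m := 1) le_rfl).differentiable one_ne_zero)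

lemma inner_fderiv_gradient_apply (hf : ContDiff ℝ 2 f) (x u v : V) :
    inner ℝ (fderiv ℝ (gradient f) x u) v = fderiv ℝ (fderiv ℝ f) x u v := by
  have hgrad := (differentiable_gradient hf x).hasFDerivAt.inner ℝ (hasFDerivAt_const v x)
  have hdiff := ((hf.fderiv_right (m := 1) le_rfl).differentiable one_ne_zero x
    ).hasFDerivAt.clm_apply (hasFDerivAt_const v x)
  have heq : (fun y => inner ℝ (gradient f y) v) = fun y => fderiv ℝ f y v :=
    funext fun _ => inner_gradient_left
  rw [heq] at hgrad
  simpa using DFunLike.congr_fun (hgrad.unique hdiff) u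

lemma isSelfAdjoint_fderiv_gradient (hf : ContDiff ℝ 2 f) (x : V) :
    IsSelfAdjoint (fderiv ℝ (gradient f) x) := by
  refine ContinuousLinearMap.isSelfAdjoint_iff_isSymmetric.2 fun u v => ?_
  have hsymm : fderiv ℝ (fderiv ℝ f) x u v = fderiv ℝ (fderiv ℝ f) x v u :=
    hf.contDiffAt.isSymmSndFDerivAt (by simp) u v
  simp only [ContinuousLinearMap.coe_coe]
  rw [inner_fderiv_gradient_apply hf, hsymm, real_inner_comm, inner_fderiv_gradient_apply hf]

lemma isSelfAdjoint_avgFDeriv_gradient (hf : ContDiff ℝ 2 f) (x s : V) :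
    IsSelfAdjoint (avgFDeriv (gradient f) x s) :=
  isSelfAdjoint_intervalIntegral (fun _ => isSelfAdjoint_fderiv_gradient hf _) 0 1

lemma abs_apply_add_sub_taylor_le (hf : ContDiff ℝ 2 f)
    (hL : LipschitzWith L (fderiv ℝ (gradient f))) (x s : V) :
    |f (x + s) - f x - inner ℝ (gradient f x) s - 1 / 2 * inner ℝ s (fderiv ℝ (gradient f) x s)| ≤
      L / 6 * ‖s‖ ^ 3 := by
  set H := fderiv ℝ (gradient f) x
  set remainder : ℝ → ℝ := fun t =>
    f (x + t • s) - f x - t * inner ℝ (gradient f x) s - t ^ 2 / 2 * inner ℝ s (H s) with hrem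
  have hderiv : ∀ t, HasDerivAt remainder
      (inner ℝ (gradient f (x + t • s) - gradient f x - H (t • s)) s) t := fun t => by
    have hf' := hasDerivAt_comp_add_smul (hf.differentiable two_ne_zero) x s t
    refine (((hf'.sub_const (f x)).sub
      ((hasDerivAt_id t).mul_const (inner ℝ (gradient f x) s))).sub
      (((hasDerivAt_pow 2 t).div_const 2).mul_const (inner ℝ s (H s)))).congr_deriv ?_
    rw [inner_sub_left, inner_sub_left, map_smul, real_inner_smul_left, inner_gradient_left,
      real_inner_comm (H s) s]
    simp
  have hderiv_le : ∀ t ∈ Set.Ico (0 : ℝ) 1,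
      ‖inner ℝ (gradient f (x + t • s) - gradient f x - H (t • s)) s‖ ≤
        L / 6 * ‖s‖ ^ 3 * (3 * t ^ 2) := fun t ht => by
    have hgrad := norm_add_sub_sub_fderiv_le (differentiable_gradient hf) hL x (t • s)
    rw [norm_smul, Real.norm_of_nonneg ht.1] at hgrad
    calc _ ≤ ‖gradient f (x + t • s) - gradient f x - H (t • s)‖ * ‖s‖ := norm_inner_le_norm _ _
      _ ≤ L / 2 * (t * ‖s‖) ^ 2 * ‖s‖ := by gcongr
      _ = L / 6 * ‖s‖ ^ 3 * (3 * t ^ 2) := by ring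
  have hbound := image_norm_le_of_norm_deriv_right_le_deriv_boundary (a := 0) (b := 1)
    (B := fun t => L / 6 * ‖s‖ ^ 3 * t ^ 3)
    (fun t _ => (hderiv t).continuousAt.continuousWithinAt)
    (fun t _ => (hderiv t).hasDerivWithinAt) (by simp [hrem])
    (fun t => by simpa using (hasDerivAt_pow 3 t).const_mul (L / 6 * ‖s‖ ^ 3)) hderiv_le
    (Set.right_mem_Icc.2 zero_le_one)
  simpa [hrem] using hbound

end Gradient

/-! ### Finite-difference Hessians -/

lemma norm_inv_smul_sub_fderiv_le {V W : Type*} [NormedAddCommGroup V] [NormedSpace ℝ V]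
    [NormedAddCommGroup W] [NormedSpace ℝ W] [CompleteSpace W] {g : V → W} {L : ℝ≥0}
    (hg : Differentiable ℝ g) (hL : LipschitzWith L (fderiv ℝ g)) (x u : V) {h : ℝ} (hh : h ≠ 0) :
    ‖h⁻¹ • (g (x + h • u) - g x) - fderiv ℝ g x u‖ ≤ L / 2 * |h| * ‖u‖ ^ 2 := by
  have hscale : h⁻¹ • (g (x + h • u) - g x) - fderiv ℝ g x u =
      h⁻¹ • (g (x + h • u) - g x - fderiv ℝ g x (h • u)) := by
    rw [map_smul, smul_sub _ _ (h • fderiv ℝ g x u), inv_smul_smul₀ hh]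
  calc _ = |h|⁻¹ * ‖g (x + h • u) - g x - fderiv ℝ g x (h • u)‖ := by
        rw [hscale, norm_smul, norm_inv, Real.norm_eq_abs]
    _ ≤ |h|⁻¹ * (L / 2 * ‖h • u‖ ^ 2) := by gcongr; exact norm_add_sub_sub_fderiv_le hg hL x _
    _ = L / 2 * |h| * ‖u‖ ^ 2 := by
        rw [norm_smul, Real.norm_eq_abs]
        field_simp

lemma norm_le_sqrt_card_mul {ι 𝕜 V W : Type*} [Fintype ι] [RCLike 𝕜] [NormedAddCommGroup V]
    [InnerProductSpace 𝕜 V] [SeminormedAddCommGroup W] [NormedSpace 𝕜 W]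
    (b : OrthonormalBasis ι 𝕜 V) {A : V →L[𝕜] W} {c : ℝ} (hc : 0 ≤ c)
    (hA : ∀ i, ‖A (b i)‖ ≤ c) : ‖A‖ ≤ Real.sqrt (Fintype.card ι) * c := by
  refine A.opNorm_le_bound (by positivity) fun v => ?_
  have hcauchy : ∑ i, ‖b.repr v i‖ ≤ Real.sqrt (Fintype.card ι) * ‖v‖ := by
    rw [← b.repr.norm_map v, EuclideanSpace.norm_eq]
    simpa using Real.sum_mul_le_sqrt_mul_sqrt Finset.univ (fun _ => (1 : ℝ)) fun i => ‖b.repr v i‖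
  calc ‖A v‖ = ‖∑ i, b.repr v i • A (b i)‖ := by
        conv_lhs => rw [← b.sum_repr v]
        simp only [map_sum, map_smul]
    _ ≤ ∑ i, ‖b.repr v i‖ * c := (norm_sum_le _ _).trans <| by
        gcongr with i
        rw [norm_smul]
        gcongr
        exact hA i
    _ ≤ Real.sqrt (Fintype.card ι) * ‖v‖ * c := by
        rw [← Finset.sum_mul]
        gcongr
    _ = Real.sqrt (Fintype.card ι) * c * ‖v‖ := by ring

lemma fdHess_apply_basisVec (f : E n → ℝ) (x : E n) (h : ℝ) (i : Fin n) :
    fdHess f x h (basisVec i) = h⁻¹ • (gradient f (x + h • basisVec i) - gradient f x) := by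
  simp [fdHess, basisVec, EuclideanSpace.inner_single_left]

lemma norm_fdHess_sub_hess_le {f : E n → ℝ} {L : ℝ≥0} (hf : ContDiff ℝ 2 f)
    (hL : LipschitzWith L (hess f)) (x : E n) {h : ℝ} (hh : 0 < h) :
    ‖fdHess f x h - hess f x‖ ≤ L / 2 * (h * Real.sqrt n) := by
  have hcol (i : Fin n) : ‖(fdHess f x h - hess f x) (EuclideanSpace.basisFun (Fin n) ℝ i)‖ ≤
      L / 2 * h := by
    have hbasis : EuclideanSpace.basisFun (Fin n) ℝ i = basisVec i := by simp [basisVec]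
    have hnorm : ‖(basisVec i : E n)‖ = 1 := by simp [basisVec]
    rw [hbasis, sub_apply, fdHess_apply_basisVec, hess]
    simpa only [hnorm, one_pow, mul_one, abs_of_pos hh] using
      norm_inv_smul_sub_fderiv_le (differentiable_gradient hf) hL x (basisVec i) hh.ne'
  refine (norm_le_sqrt_card_mul (EuclideanSpace.basisFun (Fin n) ℝ)
    (by positivity) hcol).trans_eq ?_
  rw [Fintype.card_fin]
  ring

lemma isSelfAdjoint_symPart (A : Op n) : IsSelfAdjoint (symPart A) :=
  IsSelfAdjoint.smul (.all _) (IsSelfAdjoint.add_star_self A)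

lemma norm_symPart_sub_le (A : Op n) {H : Op n} (hH : IsSelfAdjoint H) :
    ‖symPart A - H‖ ≤ ‖A - H‖ := by
  have hadj : ContinuousLinearMap.adjoint H = H := hH
  have hsplit : symPart A - H = (1 / 2 : ℝ) • ((A - H) + ContinuousLinearMap.adjoint (A - H)) := by
    rw [symPart, map_sub, hadj]
    module
  calc ‖symPart A - H‖ ≤ 1 / 2 * (‖A - H‖ + ‖ContinuousLinearMap.adjoint (A - H)‖) := by
        rw [hsplit, norm_smul, Real.norm_of_nonneg (by norm_num)]
        gcongr
        exact norm_add_le _ _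
    _ = ‖A - H‖ := by
        rw [LinearIsometryEquiv.norm_map]
        ring

/-! ### Scalar recursions -/

section Window

variable {a : ℤ → ℝ}

/-- The sum of the `M` consecutive terms of `a` that end at index `k`. -/
def window (a : ℤ → ℝ) (M : ℕ) (k : ℤ) : ℝ := ∑ i ∈ Finset.range M, a (k - i)

lemma window_succ (a : ℤ → ℝ) (M : ℕ) (k : ℤ) :
    window a (M + 1) k = a k + window a M (k - 1) := by
  rw [window, Finset.sum_range_succ', Nat.cast_zero, sub_zero, add_comm, window]
  congr! 3
  push_cast
  ring

lemma window_nonneg (ha : ∀ j, 0 ≤ a j) (M : ℕ) (k : ℤ) : 0 ≤ window a M k :=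
  Finset.sum_nonneg fun _ _ => ha _

lemma window_mono (ha : ∀ j, 0 ≤ a j) {M M' : ℕ} (hM : M ≤ M') (k : ℤ) :
    window a M k ≤ window a M' k :=
  Finset.sum_le_sum_of_subset_of_nonneg (Finset.range_subset_range.2 hM) fun _ _ _ => ha _

lemma sum_sub_le_add_sum {b : ℤ → ℝ} (hb : ∀ j, 0 ≤ b j) (hneg : ∀ j < 0, b j = 1) (N i : ℕ) :
    ∑ k ∈ Finset.range N, b ((k : ℤ) - (i : ℤ)) ≤ i + ∑ k ∈ Finset.range N, b k := by
  induction i with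
  | zero => simp
  | succ i ih =>
    cases N with
    | zero => simp only [Finset.range_zero, Finset.sum_empty, add_zero]; positivity
    | succ N =>
      have hshift (k : ℕ) : ((k + 1 : ℕ) : ℤ) - ((i + 1 : ℕ) : ℤ) = (k : ℤ) - (i : ℤ) := by
        push_cast; ring
      rw [Finset.sum_range_succ', hneg (((0 : ℕ) : ℤ) - ((i + 1 : ℕ) : ℤ)) (by omega)]
      rw [Finset.sum_range_succ] at ih
      simp only [hshift]
      push_cast
      linarith [hb ((N : ℤ) - (i : ℤ))]

lemma sum_window_cube_le (ha : ∀ j, 0 ≤ a j) (hneg : ∀ j < 0, a j = 1) (M N : ℕ) :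
    ∑ k ∈ Finset.range N, window a M k ^ 3 ≤
      (M : ℝ) ^ 3 * (M + ∑ k ∈ Finset.range N, a k ^ 3) := by
  calc ∑ k ∈ Finset.range N, window a M k ^ 3
      ≤ ∑ k ∈ Finset.range N,
          (M : ℝ) ^ 2 * ∑ i ∈ Finset.range M, a ((k : ℤ) - (i : ℤ)) ^ 3 := by
        gcongr with k
        simpa only [Finset.card_range, window] using
          pow_sum_le_card_mul_sum_pow (s := Finset.range M)
            (fun i _ => ha ((k : ℤ) - (i : ℤ))) 2
    _ = (M : ℝ) ^ 2 * ∑ i ∈ Finset.range M,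
          ∑ k ∈ Finset.range N, a ((k : ℤ) - (i : ℤ)) ^ 3 := by
        rw [← Finset.mul_sum, Finset.sum_comm]
    _ ≤ (M : ℝ) ^ 2 * ∑ i ∈ Finset.range M, (M + ∑ k ∈ Finset.range N, a k ^ 3) := by
        gcongr with i hi
        refine (sum_sub_le_add_sum (b := fun j => a j ^ 3) (fun j => pow_nonneg (ha j) 3)
          (fun j hj => by rw [hneg j hj, one_pow]) N i).trans ?_
        gcongr
        exact (Finset.mem_range.1 hi).le
    _ = (M : ℝ) ^ 3 * (M + ∑ k ∈ Finset.range N, a k ^ 3) := by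
        rw [Finset.sum_const, Finset.card_range, nsmul_eq_mul]
        ring

end Window

/-- The inequalities between step lengths `a`, regularization parameters `σ`, optimality gaps `φ`,
gradient norms `γ` and Hessian errors `e` that govern the first `K` iterations. Everything the
complexity bound needs to know about the method is recorded here. -/
structure StepBounds (L Δ G σ₀ θ : ℝ) (M K : ℕ) (a : ℤ → ℝ) (σ φ γ e : ℕ → ℝ) : Prop where
  lipschitz_nonneg : 0 ≤ L
  tol_nonneg : 0 ≤ θ
  reg_zero_pos : 0 < σ₀
  len_nonneg : ∀ j, 0 ≤ a j
  len_neg : ∀ j < 0, a j = 1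
  reg_zero : σ 0 = σ₀
  gap_zero : φ 0 ≤ Δ
  gap_nonneg : ∀ k, 0 ≤ φ k
  grad_zero : γ 0 ≤ G
  grad_nonneg : ∀ k, 0 ≤ γ k
  err_le : ∀ k < K, e k ≤ L * window a M (k - 1)
  reg_succ : ∀ k < K, σ (k + 1) = σ k + σ k * a k ^ 3
  gap_succ : ∀ k < K, φ (k + 1) ≤ φ k - σ k / 6 * a k ^ 3 + L / 6 * a k ^ 3 + e k / 2 * a k ^ 2
  grad_succ : ∀ k < K, γ (k + 1) ≤ (θ * σ k + L) / 2 * a k ^ 2 + e k * a k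
  len_le : ∀ k < K, 1 ≤ a k → σ k / 6 * a k ≤ 2 * γ k + φ k + L / 6 + e k / 2

namespace StepBounds

variable {L Δ G σ₀ θ : ℝ} {M K : ℕ} {a : ℤ → ℝ} {σ φ γ e : ℕ → ℝ}

lemma le_reg (h : StepBounds L Δ G σ₀ θ M K a σ φ γ e) : ∀ k ≤ K, σ₀ ≤ σ k := by
  intro k
  induction k with
  | zero => exact fun _ => h.reg_zero.ge
  | succ k ih =>
    intro hk
    have hσk : σ₀ ≤ σ k := ih (by omega)
    rw [h.reg_succ k hk]
    have := mul_nonneg (h.reg_zero_pos.le.trans hσk) (pow_nonneg (h.len_nonneg k) 3)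
    linarith

lemma reg_nonneg (h : StepBounds L Δ G σ₀ θ M K a σ φ γ e) {k : ℕ} (hk : k ≤ K) : 0 ≤ σ k :=
  h.reg_zero_pos.le.trans (h.le_reg k hk)

lemma reg_mono (h : StepBounds L Δ G σ₀ θ M K a σ φ γ e) {i j : ℕ} (hij : i ≤ j) (hj : j ≤ K) :
    σ i ≤ σ j := by
  induction j, hij using Nat.le_induction with
  | base => exact le_rfl
  | succ j _ ih =>
    rw [h.reg_succ j hj]
    have := mul_nonneg (h.reg_nonneg (by omega : j ≤ K)) (pow_nonneg (h.len_nonneg j) 3)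
    linarith [ih (by omega)]

lemma mul_sum_cube_le (h : StepBounds L Δ G σ₀ θ M K a σ φ γ e) :
    ∀ N ≤ K, σ₀ * ∑ k ∈ Finset.range N, a k ^ 3 ≤ σ N - σ₀ := by
  intro N
  induction N with
  | zero => simp [h.reg_zero]
  | succ N ih =>
    intro hN
    rw [Finset.sum_range_succ, mul_add, h.reg_succ N hN]
    have := mul_le_mul_of_nonneg_right (h.le_reg N (by omega)) (pow_nonneg (h.len_nonneg N) 3)
    linarith [ih (by omega)]

lemma sum_cube_le_div (h : StepBounds L Δ G σ₀ θ M K a σ φ γ e) {N : ℕ} (hN : N ≤ K) {τ : ℝ}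
    (hτ : σ N ≤ τ) : ∑ k ∈ Finset.range N, a k ^ 3 ≤ τ / σ₀ := by
  rw [le_div_iff₀ h.reg_zero_pos]
  linarith [h.mul_sum_cube_le N hN, h.reg_zero_pos]

lemma len_le_window (h : StepBounds L Δ G σ₀ θ M K a σ φ γ e) (k : ℤ) :
    a k ≤ window a (M + 1) k := by
  rw [window_succ]
  linarith [window_nonneg h.len_nonneg M (k - 1)]

lemma err_le_window (h : StepBounds L Δ G σ₀ θ M K a σ φ γ e) {k : ℕ} (hk : k < K) :
    e k ≤ L * window a (M + 1) k := by
  refine (h.err_le k hk).trans (mul_le_mul_of_nonneg_left ?_ h.lipschitz_nonneg)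
  rw [window_succ]
  linarith [h.len_nonneg k]

lemma gap_succ_le_window (h : StepBounds L Δ G σ₀ θ M K a σ φ γ e) {k : ℕ} (hk : k < K) :
    φ (k + 1) ≤ φ k - σ k / 6 * a k ^ 3 + L * window a (M + 1) k ^ 3 := by
  have hL := h.lipschitz_nonneg
  have ha := h.len_nonneg k
  have hav := h.len_le_window k
  have herr := h.err_le_window hk
  set v := window a (M + 1) k
  have hv : 0 ≤ v := ha.trans hav
  calc φ (k + 1) ≤ φ k - σ k / 6 * a k ^ 3 + L / 6 * a k ^ 3 + e k / 2 * a k ^ 2 := h.gap_succ k hk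
    _ ≤ φ k - σ k / 6 * a k ^ 3 + L / 6 * v ^ 3 + L * v / 2 * v ^ 2 := by gcongr
    _ ≤ φ k - σ k / 6 * a k ^ 3 + L * v ^ 3 := by
        linarith [mul_nonneg hL (pow_nonneg hv 3)]

lemma gap_add_reg_le (h : StepBounds L Δ G σ₀ θ M K a σ φ γ e) {N : ℕ} (hN : N ≤ K) :
    φ N + (σ N - σ₀) / 6 ≤
      Δ + L * (M + 1) ^ 3 * (M + 1 + ∑ k ∈ Finset.range N, a k ^ 3) := by
  have htelescope : ∀ N ≤ K, φ N + (σ N - σ₀) / 6 ≤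
      Δ + L * ∑ k ∈ Finset.range N, window a (M + 1) k ^ 3 := by
    intro N
    induction N with
    | zero => simp [h.reg_zero, h.gap_zero]
    | succ N ih =>
      intro hN
      rw [Finset.sum_range_succ, h.reg_succ N hN]
      linarith [ih (by omega), h.gap_succ_le_window hN]
  have hcubes := mul_le_mul_of_nonneg_left
    (sum_window_cube_le h.len_nonneg h.len_neg (M + 1) N) h.lipschitz_nonneg
  push_cast at hcubes
  linarith [htelescope N hN]

section UpTo

variable {N : ℕ} {τ : ℝ}

lemma len_le_of_reg_le (h : StepBounds L Δ G σ₀ θ M K a σ φ γ e) (hN : N ≤ K) (hτ : σ N ≤ τ)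
    {j : ℤ} (hj : j < N) : a j ≤ 1 + τ / σ₀ := by
  have hsum := h.sum_cube_le_div hN hτ
  have hcube (k : ℕ) : 0 ≤ a k ^ 3 := pow_nonneg (h.len_nonneg k) 3
  have hτ₀ : 0 ≤ τ / σ₀ := (Finset.sum_nonneg fun k _ => hcube k).trans hsum
  rcases lt_or_ge j 0 with hneg | hnonneg
  · linarith [h.len_neg j hneg]
  · lift j to ℕ using hnonneg
    have hj_cube : a j ^ 3 ≤ τ / σ₀ := (Finset.single_le_sum (f := fun k : ℕ => a k ^ 3)
      (fun k _ => hcube k) (Finset.mem_range.2 (by exact_mod_cast hj))).trans hsum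
    rcases le_total (a j) 1 with hle | hge
    · linarith
    · linarith [le_self_pow₀ hge three_ne_zero]

lemma err_le_of_reg_le (h : StepBounds L Δ G σ₀ θ M K a σ φ γ e) (hN : N < K) (hτ : σ N ≤ τ)
    {k : ℕ} (hk : k ≤ N) : e k ≤ L * M * (1 + τ / σ₀) := by
  have hwindow : window a M (k - 1) ≤ M * (1 + τ / σ₀) := by
    simpa only [window, Finset.card_range, nsmul_eq_mul] using
      Finset.sum_le_card_nsmul (Finset.range M) (fun i : ℕ => a ((k : ℤ) - 1 - i)) (1 + τ / σ₀)
        fun i _ => h.len_le_of_reg_le hN.le hτ (by omega)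
  rw [mul_assoc]
  exact (h.err_le k (by omega)).trans (mul_le_mul_of_nonneg_left hwindow h.lipschitz_nonneg)

lemma grad_le_of_reg_le (h : StepBounds L Δ G σ₀ θ M K a σ φ γ e) (hN : N < K) (hτ : σ N ≤ τ) :
    γ N ≤ G + ((θ * τ + L) / 2 + L * M) * (1 + τ / σ₀) ^ 2 := by
  have hL := h.lipschitz_nonneg
  have hθ := h.tol_nonneg
  have hτ₀ : 0 ≤ τ := (h.reg_nonneg hN.le).trans hτ
  have hℓ : 0 ≤ 1 + τ / σ₀ := by have := h.reg_zero_pos; positivity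
  cases N with
  | zero =>
    have : 0 ≤ ((θ * τ + L) / 2 + L * M) * (1 + τ / σ₀) ^ 2 := by positivity
    linarith [h.grad_zero]
  | succ p =>
    have ha := h.len_nonneg p
    have ha_le : a p ≤ 1 + τ / σ₀ := h.len_le_of_reg_le hN.le hτ (by push_cast; omega)
    have hσp : σ p ≤ τ := (h.reg_mono p.le_succ hN.le).trans hτ
    have herr := h.err_le_of_reg_le hN hτ p.le_succ
    set ℓ := 1 + τ / σ₀
    calc γ (p + 1) ≤ (θ * σ p + L) / 2 * a p ^ 2 + e p * a p := h.grad_succ p (by omega)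
      _ ≤ (θ * τ + L) / 2 * ℓ ^ 2 + L * M * ℓ * ℓ := by gcongr
      _ = 0 + ((θ * τ + L) / 2 + L * M) * ℓ ^ 2 := by ring
      _ ≤ G + ((θ * τ + L) / 2 + L * M) * ℓ ^ 2 := by
          gcongr
          exact (h.grad_nonneg 0).trans h.grad_zero

lemma gap_le_of_reg_le (h : StepBounds L Δ G σ₀ θ M K a σ φ γ e) (hN : N ≤ K) (hτ : σ N ≤ τ) :
    φ N ≤ Δ + L * (M + 1) ^ 3 * (M + 1 + τ / σ₀) := by
  have hL := h.lipschitz_nonneg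
  calc φ N ≤ φ N + (σ N - σ₀) / 6 := by linarith [h.le_reg N hN]
    _ ≤ Δ + L * (M + 1) ^ 3 * (M + 1 + ∑ k ∈ Finset.range N, a k ^ 3) := h.gap_add_reg_le hN
    _ ≤ Δ + L * (M + 1) ^ 3 * (M + 1 + τ / σ₀) := by
        gcongr
        exact h.sum_cube_le_div hN hτ

end UpTo

end StepBounds

/-- A bound on the length of a step taken with a regularization parameter at most `τ`. -/
def lenBound (L Δ G σ₀ θ : ℝ) (M : ℕ) (τ : ℝ) : ℝ :=
  max 1 (6 / σ₀ * (2 * (G + ((θ * τ + L) / 2 + L * M) * (1 + τ / σ₀) ^ 2) +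
    (Δ + L * (M + 1) ^ 3 * (M + 1 + τ / σ₀)) + L / 6 + L * M * (1 + τ / σ₀) / 2))

/-- A bound on all regularization parameters. From the threshold `12 L (M + 1)³` on, the model
decrease outweighs the effect of the Hessian errors. -/
def regBound (L Δ G σ₀ θ : ℝ) (M : ℕ) : ℝ :=
  σ₀ + 12 * (Δ + L * (M + 1) ^ 3 * (M + 1 + 12 * (L * (M + 1) ^ 3) / σ₀ +
    lenBound L Δ G σ₀ θ M (12 * (L * (M + 1) ^ 3)) ^ 3))

/-- The factor in front of `max (ε₁ ^ (-3/2)) (ε₂ ^ (-3))` in the bound on the number of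
iterations. -/
def iterBound (L Δ G σ₀ θ₁ θ₂ : ℝ) (M : ℕ) : ℝ :=
  ((θ₁ + θ₂) * regBound L Δ G σ₀ θ₁ M + 2 * L + 1) ^ 3 *
    ((M + 1) ^ 3 * (M + 1 + regBound L Δ G σ₀ θ₁ M / σ₀))

lemma one_le_max_rpow_mul_cube {ε₁ ε₂ y : ℝ} (hε₁ : 0 < ε₁) (hε₂ : 0 < ε₂) (hy : 0 ≤ y)
    (h : ε₁ ≤ y ^ 2 ∨ ε₂ ≤ y) : 1 ≤ max (ε₁ ^ (-(3 / 2) : ℝ)) (ε₂ ^ (-3 : ℝ)) * y ^ 3 := by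
  rcases h with h | h
  · have hpow : ε₁ ^ (3 / 2 : ℝ) ≤ y ^ 3 := by
      calc ε₁ ^ (3 / 2 : ℝ) ≤ (y ^ 2) ^ (3 / 2 : ℝ) := by gcongr
        _ = y ^ 3 := by
            rw [← Real.rpow_natCast, ← Real.rpow_natCast, ← Real.rpow_mul hy]
            norm_num
    calc (1 : ℝ) = ε₁ ^ (-(3 / 2) : ℝ) * ε₁ ^ (3 / 2 : ℝ) := by
          rw [← Real.rpow_add hε₁, neg_add_cancel, Real.rpow_zero]
      _ ≤ _ := by gcongr; exact le_max_left _ _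
  · calc (1 : ℝ) = ε₂ ^ (-3 : ℝ) * ε₂ ^ 3 := by
          rw [← Real.rpow_natCast, ← Real.rpow_add hε₂]
          norm_num
      _ ≤ _ := by gcongr; exact le_max_right _ _

namespace StepBounds

variable {L Δ G σ₀ θ : ℝ} {M K : ℕ} {a : ℤ → ℝ} {σ φ γ e : ℕ → ℝ}

lemma len_le_lenBound (h : StepBounds L Δ G σ₀ θ M K a σ φ γ e) {N : ℕ} (hN : N < K) {τ : ℝ}
    (hτ : σ N ≤ τ) : a N ≤ lenBound L Δ G σ₀ θ M τ := by
  have hσ₀ := h.reg_zero_pos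
  rcases le_total (a N) 1 with hle | hge
  · exact hle.trans (le_max_left _ _)
  refine le_max_of_le_right ?_
  calc a N = 6 / σ₀ * (σ₀ / 6 * a N) := by field_simp
    _ ≤ 6 / σ₀ * (σ N / 6 * a N) := by
        have := h.len_nonneg N
        gcongr
        exact h.le_reg N hN.le
    _ ≤ 6 / σ₀ * (2 * γ N + φ N + L / 6 + e N / 2) := by gcongr; exact h.len_le N hN hge
    _ ≤ _ := by
        gcongr
        exacts [h.grad_le_of_reg_le hN hτ, h.gap_le_of_reg_le hN.le hτ,
          h.err_le_of_reg_le hN hτ le_rfl]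

lemma mul_sum_cube_le_add (h : StepBounds L Δ G σ₀ θ M K a σ φ γ e) {c : ℝ} (hc : 0 ≤ c) :
    ∀ N ≤ K, c * ∑ k ∈ Finset.range N, a k ^ 3 ≤
      (σ N - σ₀) / 12 + c * (12 * c / σ₀ + lenBound L Δ G σ₀ θ M (12 * c) ^ 3) := by
  have hσ₀ := h.reg_zero_pos
  have hρ : 0 ≤ lenBound L Δ G σ₀ θ M (12 * c) := zero_le_one.trans (le_max_left _ _)
  set ρ := lenBound L Δ G σ₀ θ M (12 * c)
  intro N
  induction N with
  | zero =>
    have : 0 ≤ c * (12 * c / σ₀ + ρ ^ 3) := by positivity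
    simpa [h.reg_zero] using this
  | succ N ih =>
    intro hN
    rw [Finset.sum_range_succ]
    rcases le_total (σ N) (12 * c) with hsmall | hlarge
    · have hsum : ∑ k ∈ Finset.range N, a k ^ 3 + a N ^ 3 ≤ 12 * c / σ₀ + ρ ^ 3 := by
        gcongr
        exacts [h.sum_cube_le_div (by omega) hsmall, h.len_nonneg N, h.len_le_lenBound hN hsmall]
      linarith [mul_le_mul_of_nonneg_left hsum hc, h.le_reg (N + 1) hN]
    · rw [h.reg_succ N hN]
      linarith [ih (by omega), mul_le_mul_of_nonneg_right hlarge (pow_nonneg (h.len_nonneg N) 3)]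

lemma reg_le_regBound (h : StepBounds L Δ G σ₀ θ M K a σ φ γ e) {N : ℕ} (hN : N ≤ K) :
    σ N ≤ regBound L Δ G σ₀ θ M := by
  have hL := h.lipschitz_nonneg
  have hcubes := h.mul_sum_cube_le_add (by positivity : 0 ≤ L * ((M : ℝ) + 1) ^ 3) N hN
  rw [regBound]
  linarith [h.gap_add_reg_le hN, h.gap_nonneg N]

lemma one_le_max_rpow_mul_window_cube (h : StepBounds L Δ G σ₀ θ M K a σ φ γ e)
    {θ₂ T ε₁ ε₂ : ℝ} (hθ₂ : 0 ≤ θ₂) (hε₁ : 0 < ε₁) (hε₂ : 0 < ε₂) {k : ℕ} (hk : k < K)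
    (hT : σ k ≤ T) (hlarge : ε₁ ≤ γ (k + 1) ∨ ε₂ ≤ (θ₂ * σ k + L) * a k + e k) :
    1 ≤ max (ε₁ ^ (-(3 / 2) : ℝ)) (ε₂ ^ (-3 : ℝ)) *
      (((θ + θ₂) * T + 2 * L + 1) * window a (M + 1) k) ^ 3 := by
  have hL := h.lipschitz_nonneg
  have hθ := h.tol_nonneg
  have ha := h.len_nonneg k
  have hσ := h.reg_nonneg hk.le
  have hT₀ : 0 ≤ T := hσ.trans hT
  have hav := h.len_le_window k
  have herr := h.err_le_window hk
  set v := window a (M + 1) k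
  have hv : 0 ≤ v := ha.trans hav
  set A := (θ + θ₂) * T + 2 * L + 1
  have hθT : 0 ≤ θ * T := mul_nonneg hθ hT₀
  have hθ₂T : 0 ≤ θ₂ * T := mul_nonneg hθ₂ hT₀
  have hA₁ : 1 ≤ A := by linarith
  refine one_le_max_rpow_mul_cube hε₁ hε₂ (by positivity)
    (hlarge.imp (fun hγ => ?_) fun hcurv => ?_)
  · calc ε₁ ≤ (θ * σ k + L) / 2 * a k ^ 2 + e k * a k := hγ.trans (h.grad_succ k hk)
      _ ≤ (θ * T + L) / 2 * v ^ 2 + L * v * v := by gcongr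
      _ = ((θ * T + L) / 2 + L) * v ^ 2 := by ring
      _ ≤ A ^ 2 * v ^ 2 := by gcongr; linarith [le_self_pow₀ hA₁ two_ne_zero]
      _ = (A * v) ^ 2 := by ring
  · calc ε₂ ≤ (θ₂ * T + L) * v + L * v := hcurv.trans (by gcongr)
      _ = (θ₂ * T + 2 * L) * v := by ring
      _ ≤ A * v := by gcongr; linarith

lemma iterations_le (h : StepBounds L Δ G σ₀ θ M K a σ φ γ e) {θ₂ ε₁ ε₂ : ℝ} (hθ₂ : 0 ≤ θ₂)
    (hε₁ : 0 < ε₁) (hε₂ : 0 < ε₂)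
    (hlarge : ∀ k < K, ε₁ ≤ γ (k + 1) ∨ ε₂ ≤ (θ₂ * σ k + L) * a k + e k) :
    (K : ℝ) ≤ iterBound L Δ G σ₀ θ θ₂ M * max (ε₁ ^ (-(3 / 2) : ℝ)) (ε₂ ^ (-3 : ℝ)) := by
  have hT := fun k (hk : k ≤ K) => h.reg_le_regBound hk
  have hT₀ := (h.reg_nonneg le_rfl).trans (hT K le_rfl)
  rw [iterBound]
  set T := regBound L Δ G σ₀ θ M
  set X := max (ε₁ ^ (-(3 / 2) : ℝ)) (ε₂ ^ (-3 : ℝ))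
  set A := (θ + θ₂) * T + 2 * L + 1
  have hA₀ : 0 ≤ A := by
    have := h.lipschitz_nonneg
    have := h.tol_nonneg
    positivity
  have : 0 ≤ X := le_max_of_le_left (by positivity)
  calc (K : ℝ) = ∑ _k ∈ Finset.range K, (1 : ℝ) := by simp
    _ ≤ ∑ k ∈ Finset.range K, X * (A * window a (M + 1) k) ^ 3 :=
        Finset.sum_le_sum fun k hk => by
          have hk := Finset.mem_range.1 hk
          exact h.one_le_max_rpow_mul_window_cube hθ₂ hε₁ hε₂ hk (hT k hk.le) (hlarge k hk)
    _ = X * A ^ 3 * ∑ k ∈ Finset.range K, window a (M + 1) k ^ 3 := by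
        simp only [mul_pow, Finset.mul_sum, mul_assoc]
    _ ≤ X * A ^ 3 * ((M + 1) ^ 3 * (M + 1 + T / σ₀)) := by
        gcongr
        refine (sum_window_cube_le h.len_nonneg h.len_neg (M + 1) K).trans ?_
        push_cast
        gcongr
        exact h.sum_cube_le_div le_rfl (hT K le_rfl)
    _ = A ^ 3 * ((M + 1) ^ 3 * (M + 1 + T / σ₀)) * X := by ring

end StepBounds

/-! ### One iteration -/

lemma abs_inner_apply_le {V : Type*} [NormedAddCommGroup V] [InnerProductSpace ℝ V]
    (A : V →L[ℝ] V) (u : V) : |inner ℝ u (A u)| ≤ ‖A‖ * ‖u‖ ^ 2 :=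
  calc |inner ℝ u (A u)| ≤ ‖u‖ * ‖A u‖ := abs_real_inner_le_norm _ _
    _ ≤ ‖u‖ * (‖A‖ * ‖u‖) := by gcongr; exact A.le_opNorm u
    _ = ‖A‖ * ‖u‖ ^ 2 := by ring

lemma inner_apply_le_add {V : Type*} [NormedAddCommGroup V] [InnerProductSpace ℝ V]
    (A B : V →L[ℝ] V) (u : V) : inner ℝ u (A u) ≤ inner ℝ u (B u) + ‖A - B‖ * ‖u‖ ^ 2 := by
  have h := (le_abs_self _).trans (abs_inner_apply_le (A - B) u)
  rw [sub_apply, inner_sub_right] at h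
  linarith

lemma neg_mul_sq_le_inner_fderiv_gradient {V : Type*} [NormedAddCommGroup V]
    [InnerProductSpace ℝ V] [CompleteSpace V] {f : V → ℝ} {L : ℝ≥0} {c : ℝ} (hf : ContDiff ℝ 2 f)
    (hL : LipschitzWith L (fderiv ℝ (gradient f))) (hc : ∀ x, c ≤ f x) (x s : V) :
    -((f x - c + ‖gradient f x‖ + L / 6) * ‖s‖ ^ 2) ≤
      1 / 2 * inner ℝ s (fderiv ℝ (gradient f) x s) := by
  rcases eq_or_ne s 0 with rfl | hs
  · simp
  obtain ⟨u, hu, hsu⟩ : ∃ u : V, ‖u‖ = 1 ∧ s = ‖s‖ • u :=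
    ⟨‖s‖⁻¹ • s, norm_smul_inv_norm (𝕜 := ℝ) hs, (smul_inv_smul₀ (norm_ne_zero_iff.2 hs) s).symm⟩
  have htaylor := (abs_le.1 (abs_apply_add_sub_taylor_le hf hL x u)).2
  have hgrad := (le_abs_self _).trans (abs_real_inner_le_norm (gradient f x) u)
  rw [hu] at htaylor hgrad
  have hunit : -(f x - c + ‖gradient f x‖ + L / 6) ≤
      1 / 2 * inner ℝ u (fderiv ℝ (gradient f) x u) := by
    linarith [hc (x + u)]
  have hquad : inner ℝ s (fderiv ℝ (gradient f) x s) =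
      ‖s‖ ^ 2 * inner ℝ u (fderiv ℝ (gradient f) x u) := by
    conv_lhs => rw [hsu, map_smul, real_inner_smul_left, real_inner_smul_right]
    ring
  rw [hquad]
  linarith [mul_le_mul_of_nonneg_right hunit (sq_nonneg ‖s‖)]

section Iteration

variable {f : E n → ℝ} {x : E n} {B : Op n}

lemma hasGradientAt_approxTaylor (f : E n → ℝ) (x : E n) (hB : IsSelfAdjoint B) (s : E n) :
    HasGradientAt (approxTaylor f x B) (gradient f x + B s) s := by
  rw [hasGradientAt_iff_hasFDerivAt]
  have hquad := ((hasFDerivAt_id s).inner ℝ B.hasFDerivAt).const_mul (1 / 2 : ℝ)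
  have hlin := (innerSL ℝ (gradient f x)).hasFDerivAt (x := s)
  refine ((hlin.const_add (f x)).add hquad).congr_fderiv ?_
  ext v
  have hsymm := ContinuousLinearMap.isSelfAdjoint_iff_isSymmetric.1 hB s v
  simp only [ContinuousLinearMap.coe_coe] at hsymm
  simp [← hsymm, real_inner_comm (B s) v]
  ring

lemma gradient_approxTaylor (f : E n → ℝ) (x : E n) (hB : IsSelfAdjoint B) :
    gradient (approxTaylor f x B) = fun s => gradient f x + B s :=
  gradient_eq (hasGradientAt_approxTaylor f x hB)

lemma hess_approxTaylor (f : E n → ℝ) (x : E n) (hB : IsSelfAdjoint B) (s : E n) :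
    hess (approxTaylor f x B) s = B := by
  rw [hess, gradient_approxTaylor f x hB]
  exact (B.hasFDerivAt.const_add _).fderiv

namespace IsAcceptableStep

variable {L : ℝ≥0} {θ₁ θ₂ σ : ℝ} {s : E n}

lemma model_le (h : IsAcceptableStep f θ₁ θ₂ x B σ s) :
    inner ℝ (gradient f x) s + 1 / 2 * inner ℝ s (B s) + σ / 6 * ‖s‖ ^ 3 ≤ 0 := by
  have hdecrease := h.1
  simp only [model, approxTaylor, map_zero, inner_zero_right, norm_zero] at hdecrease
  linarith

lemma apply_add_le (h : IsAcceptableStep f θ₁ θ₂ x B σ s) (hf : ContDiff ℝ 2 f)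
    (hL : LipschitzWith L (hess f)) :
    f (x + s) ≤ f x - σ / 6 * ‖s‖ ^ 3 + L / 6 * ‖s‖ ^ 3 + ‖B - hess f x‖ / 2 * ‖s‖ ^ 2 := by
  have htaylor := (abs_le.1 (abs_apply_add_sub_taylor_le hf hL x s)).2
  have hquad := inner_apply_le_add (hess f x) B s
  rw [norm_sub_rev, hess] at hquad
  rw [hess]
  linarith [h.model_le]

lemma norm_gradient_le (h : IsAcceptableStep f θ₁ θ₂ x B σ s) (hB : IsSelfAdjoint B)
    (hf : ContDiff ℝ 2 f) (hL : LipschitzWith L (hess f)) :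
    ‖gradient f (x + s)‖ ≤ (θ₁ * σ + L) / 2 * ‖s‖ ^ 2 + ‖B - hess f x‖ * ‖s‖ := by
  have hmodel := h.2.1
  rw [gradient_approxTaylor f x hB] at hmodel
  have htaylor := norm_add_sub_sub_fderiv_le (differentiable_gradient hf) hL x s
  have herr := (B - hess f x).le_opNorm s
  calc ‖gradient f (x + s)‖
      = ‖(gradient f x + B s) + (gradient f (x + s) - gradient f x - hess f x s)
          - (B - hess f x) s‖ := by
        rw [sub_apply]
        congr 1
        abel
    _ ≤ θ₁ * σ * ‖s‖ ^ 2 / 2 + L / 2 * ‖s‖ ^ 2 + ‖B - hess f x‖ * ‖s‖ :=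
        norm_sub_le_of_le (norm_add_le_of_le hmodel htaylor) herr
    _ = (θ₁ * σ + L) / 2 * ‖s‖ ^ 2 + ‖B - hess f x‖ * ‖s‖ := by ring

lemma neg_le_lambdaMin (h : IsAcceptableStep f θ₁ θ₂ x B σ s) (hB : IsSelfAdjoint B)
    (hL : LipschitzWith L (hess f)) :
    -((θ₂ * σ + L) * ‖s‖ + ‖B - hess f x‖) ≤ lambdaMin (hess f (x + s)) := by
  have hcurv := h.2.2
  rw [hess_approxTaylor f x hB, max_le_iff] at hcurv
  have hlip : ‖hess f x - hess f (x + s)‖ ≤ L * ‖s‖ := by simpa using hL.norm_sub_le x (x + s)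
  have hLs : 0 ≤ L * ‖s‖ := by positivity
  refine le_lambdaMin (by linarith [norm_nonneg (B - hess f x)]) fun u => ?_
  calc -((θ₂ * σ + L) * ‖s‖ + ‖B - hess f x‖) * ‖u‖ ^ 2
      ≤ (lambdaMin B - ‖B - hess f x‖ - ‖hess f x - hess f (x + s)‖) * ‖u‖ ^ 2 := by
        gcongr
        linarith
    _ ≤ inner ℝ u (B u) - ‖B - hess f x‖ * ‖u‖ ^ 2
          - ‖hess f x - hess f (x + s)‖ * ‖u‖ ^ 2 := by
        linarith [lambdaMin_mul_sq_le hB u]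
    _ ≤ inner ℝ u (hess f (x + s) u) := by
        linarith [inner_apply_le_add B (hess f x) u,
          inner_apply_le_add (hess f x) (hess f (x + s)) u]

lemma norm_le (h : IsAcceptableStep f θ₁ θ₂ x B σ s) (hf : ContDiff ℝ 2 f)
    (hL : LipschitzWith L (hess f)) {c : ℝ} (hc : ∀ x, c ≤ f x) (hs : 1 ≤ ‖s‖) :
    σ / 6 * ‖s‖ ≤ 2 * ‖gradient f x‖ + (f x - c) + L / 6 + ‖B - hess f x‖ / 2 := by
  have hcurv : -((f x - c + ‖gradient f x‖ + L / 6) * ‖s‖ ^ 2) ≤ 1 / 2 * inner ℝ s (hess f x s) :=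
    neg_mul_sq_le_inner_fderiv_gradient hf hL hc x s
  have hquad := inner_apply_le_add (hess f x) B s
  rw [norm_sub_rev] at hquad
  have hlin : -(‖gradient f x‖ * ‖s‖ ^ 2) ≤ inner ℝ (gradient f x) s := by
    have hsq : ‖gradient f x‖ * ‖s‖ ≤ ‖gradient f x‖ * ‖s‖ ^ 2 := by
      gcongr
      exact le_self_pow₀ hs two_ne_zero
    linarith [(abs_le.1 (abs_real_inner_le_norm (gradient f x) s)).1]
  have hs₀ : 0 < ‖s‖ ^ 2 := by positivity
  refine le_of_mul_le_mul_right ?_ hs₀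
  linarith [h.model_le]

end IsAcceptableStep

end Iteration

/-! ### Accuracy of the Hessian approximations -/

section Accuracy

variable {f : E n → ℝ} {L : ℝ≥0}

lemma IsPSBUpdate.norm_sub_hess_le {B B' : Op n} {x s : E n}
    (h : IsPSBUpdate B s (gradient f (x + s) - gradient f x) B') (hB : IsSelfAdjoint B)
    (hf : ContDiff ℝ 2 f) (hL : LipschitzWith L (hess f)) :
    ‖B' - hess f (x + s)‖ ≤ ‖B - hess f x‖ + L * ‖s‖ := by
  set H := avgFDeriv (gradient f) x s
  have hpsb : ‖B' - H‖ ≤ ‖B - H‖ :=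
    h.norm_sub_le hB (isSelfAdjoint_avgFDeriv_gradient hf x s)
      (avgFDeriv_apply_self (differentiable_gradient hf) hL x s)
  have hleft : ‖H - hess f x‖ ≤ L / 2 * ‖s‖ := norm_avgFDeriv_sub_fderiv_left_le hL x s
  have hright : ‖H - hess f (x + s)‖ ≤ L / 2 * ‖s‖ := norm_avgFDeriv_sub_fderiv_right_le hL x s
  rw [norm_sub_rev] at hleft
  linarith [norm_sub_le_norm_sub_add_norm_sub B' H (hess f (x + s)),
    norm_sub_le_norm_sub_add_norm_sub B (hess f x) H]

lemma stepLen_natCast (R : Sequences n) (k : ℕ) : stepLen R k = ‖R.s k‖ := by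
  simp [stepLen]

lemma stepLen_of_neg (R : Sequences n) {j : ℤ} (hj : j < 0) : stepLen R j = 1 :=
  if_neg hj.not_ge

lemma stepLen_nonneg (R : Sequences n) (j : ℤ) : 0 ≤ stepLen R j := by
  rw [stepLen]
  split_ifs <;> positivity

/-- The rule for `B_k` that exact and finite-difference restarts have in common: the error of a
restart is bounded by the lengths of the `m` preceding steps. -/
def AccurateTensor (f : E n → ℝ) (L : ℝ≥0) (m : ℕ) (R : Sequences n) (k : ℕ) : Prop :=
  if k % m = 0 then
    IsSelfAdjoint (R.B k) ∧ ‖R.B k - hess f (R.x k)‖ ≤ L * window (stepLen R) m (k - 1)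
  else PSBAt f R k

variable {m : ℕ} {R : Sequences n} {k : ℕ}

lemma LazyTensor.accurateTensor (h : LazyTensor f m R k) (hf : ContDiff ℝ 2 f) (L : ℝ≥0) :
    AccurateTensor f L m R k := by
  rw [LazyTensor] at h
  rw [AccurateTensor]
  split_ifs at h ⊢
  · rw [h, sub_self, norm_zero]
    exact ⟨isSelfAdjoint_fderiv_gradient hf _,
      mul_nonneg L.2 (window_nonneg (stepLen_nonneg R) _ _)⟩
  · exact h

lemma fdStep_mul_sqrt_le_window (hn : 1 ≤ n) (m : ℕ) (R : Sequences n) (k : ℕ) :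
    fdStep m R k * √n ≤ window (stepLen R) m (k - 1) := by
  have hsqrt : √(n : ℝ) ≠ 0 := by positivity
  rw [fdStep, div_mul_cancel₀ _ hsqrt, ← Finset.Ico_add_one_right_eq_Icc,
    ← Finset.sum_Ico_add' _ 0 m 1, ← Finset.range_eq_Ico, window]
  refine (min_le_left _ _).trans_eq (Finset.sum_congr rfl fun i _ => ?_)
  push_cast
  ring_nf

lemma FDTensor.accurateTensor (h : FDTensor f m R k) (hf : ContDiff ℝ 2 f)
    (hL : LipschitzWith L (hess f)) (hn : 1 ≤ n) : AccurateTensor f L m R k := by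
  rw [FDTensor] at h
  rw [AccurateTensor]
  split_ifs at h ⊢
  · obtain ⟨hpos, hB⟩ := h
    rw [hB]
    refine ⟨isSelfAdjoint_symPart _, ?_⟩
    calc ‖symPart (fdHess f (R.x k) (fdStep m R k)) - hess f (R.x k)‖
        ≤ ‖fdHess f (R.x k) (fdStep m R k) - hess f (R.x k)‖ :=
          norm_symPart_sub_le _ (isSelfAdjoint_fderiv_gradient hf _)
      _ ≤ L / 2 * (fdStep m R k * √n) := norm_fdHess_sub_hess_le hf hL _ hpos
      _ ≤ L * window (stepLen R) m (k - 1) := by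
          gcongr
          exacts [half_le_self L.2, fdStep_mul_sqrt_le_window hn m R k]
  · exact h

lemma add_one_mod_of_ne_zero {k m : ℕ} (h : (k + 1) % m ≠ 0) : (k + 1) % m = k % m + 1 := by
  rcases m.eq_zero_or_pos with rfl | hm
  · simp only [Nat.mod_zero]
  rw [← Nat.mod_add_mod] at h ⊢
  rcases (Nat.add_one_le_iff.2 (Nat.mod_lt k hm)).lt_or_eq with hlt | heq
  · exact Nat.mod_eq_of_lt hlt
  · exact absurd (by rw [heq, Nat.mod_self]) h

lemma isSelfAdjoint_and_norm_sub_hess_le (hf : ContDiff ℝ 2 f) (hL : LipschitzWith L (hess f))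
    {K : ℕ} (htensor : ∀ k < K, AccurateTensor f L m R k)
    (hx : ∀ k < K, R.x (k + 1) = R.x k + R.s k) :
    ∀ k < K, IsSelfAdjoint (R.B k) ∧
      ‖R.B k - hess f (R.x k)‖ ≤ L * window (stepLen R) (m + k % m) (k - 1) := by
  intro k
  induction k with
  | zero => simpa [AccurateTensor] using htensor 0
  | succ k ih =>
    intro hk
    have h := htensor (k + 1) hk
    rw [AccurateTensor] at h
    split_ifs at h with hmod
    · simpa only [hmod, add_zero] using h
    obtain ⟨hB, herr⟩ := ih (by omega)
    rw [PSBAt, Nat.add_sub_cancel, hx k (by omega)] at h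
    refine ⟨h.1.1, ?_⟩
    calc ‖R.B (k + 1) - hess f (R.x (k + 1))‖
        ≤ ‖R.B k - hess f (R.x k)‖ + L * ‖R.s k‖ := by
          rw [hx k (by omega)]
          exact h.norm_sub_hess_le hB hf hL
      _ ≤ L * window (stepLen R) (m + k % m) (k - 1) + L * ‖R.s k‖ := by gcongr
      _ = L * window (stepLen R) (m + (k + 1) % m) ((k + 1 : ℕ) - 1) := by
          rw [add_one_mod_of_ne_zero hmod, ← add_assoc, Nat.cast_succ, add_sub_cancel_right,
            window_succ, stepLen_natCast]
          ring

end Accuracy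

/-! ### Complexity -/

section Complexity

variable {f : E n → ℝ} {L : ℝ≥0} {Δ G σ₀ θ₁ θ₂ c ε₁ ε₂ : ℝ} {m K : ℕ} {R : Sequences n}

lemma stepBounds_of_advances (hf : ContDiff ℝ 2 f) (hc : ∀ x, c ≤ f x)
    (hL : LipschitzWith L (hess f)) (hΔ : f (R.x 0) - c ≤ Δ) (hG : ‖gradient f (R.x 0)‖ ≤ G)
    (hσ₀ : 0 < R.σ 0) (hθ₁ : 0 ≤ θ₁) (hm : 1 ≤ m)
    (htensor : ∀ k < K, AccurateTensor f L m R k) (hadv : ∀ k < K, Advances f θ₁ θ₂ R k) :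
    StepBounds L Δ G (R.σ 0) θ₁ (2 * m) K (stepLen R) R.σ (fun k => f (R.x k) - c)
      (fun k => ‖gradient f (R.x k)‖) (fun k => ‖R.B k - hess f (R.x k)‖) where
  lipschitz_nonneg := L.2
  tol_nonneg := hθ₁
  reg_zero_pos := hσ₀
  len_nonneg := stepLen_nonneg R
  len_neg _ := stepLen_of_neg R
  reg_zero := rfl
  gap_zero := hΔ
  gap_nonneg k := sub_nonneg.2 (hc _)
  grad_zero := hG
  grad_nonneg k := norm_nonneg _
  err_le k hk := by
    refine (isSelfAdjoint_and_norm_sub_hess_le hf hL htensor (fun k hk => (hadv k hk).2.1)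
      k hk).2.trans ?_
    gcongr
    have := Nat.mod_lt k hm
    exact window_mono (stepLen_nonneg R) (by omega) _
  reg_succ k hk := by
    rw [stepLen_natCast]
    exact (hadv k hk).2.2
  gap_succ k hk := by
    rw [stepLen_natCast, (hadv k hk).2.1]
    linarith [(hadv k hk).1.apply_add_le hf hL]
  grad_succ k hk := by
    rw [stepLen_natCast, (hadv k hk).2.1]
    exact (hadv k hk).1.norm_gradient_le (isSelfAdjoint_and_norm_sub_hess_le hf hL htensor
      (fun k hk => (hadv k hk).2.1) k hk).1 hf hL
  len_le k hk hle := by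
    rw [stepLen_natCast] at hle ⊢
    exact (hadv k hk).1.norm_le hf hL hc hle

lemma iterations_le_of_advances (hf : ContDiff ℝ 2 f) (hc : ∀ x, c ≤ f x)
    (hL : LipschitzWith L (hess f)) (hΔ : f (R.x 0) - c ≤ Δ) (hG : ‖gradient f (R.x 0)‖ ≤ G)
    (hσ₀ : 0 < R.σ 0) (hθ₁ : 0 ≤ θ₁) (hθ₂ : 0 ≤ θ₂) (hm : 1 ≤ m) (hε₁ : 0 < ε₁) (hε₂ : 0 < ε₂)
    (htensor : ∀ k < K, AccurateTensor f L m R k) (hadv : ∀ k < K, Advances f θ₁ θ₂ R k)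
    (hns : ∀ k < K, ¬ IsStationary f ε₁ ε₂ (R.x (k + 1))) :
    (K : ℝ) ≤ iterBound L Δ G (R.σ 0) θ₁ θ₂ (2 * m) *
      max (ε₁ ^ (-(3 / 2) : ℝ)) (ε₂ ^ (-3 : ℝ)) := by
  refine (stepBounds_of_advances hf hc hL hΔ hG hσ₀ hθ₁ hm htensor hadv).iterations_le
    hθ₂ hε₁ hε₂ fun k hk => ?_
  have hB := isSelfAdjoint_and_norm_sub_hess_le hf hL htensor (fun k hk => (hadv k hk).2.1) k hk
  have hcurv := (hadv k hk).1.neg_le_lambdaMin hB.1 hL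
  contrapose! hns
  refine ⟨k, hk, hns.1.le, ?_⟩
  rw [stepLen_natCast] at hns
  rw [(hadv k hk).2.1]
  linarith [hns.2]

lemma IsRun.mono {x₀ : E n} {tensor tensor' : ℕ → Prop}
    (h : IsRun f θ₁ θ₂ σ₀ x₀ ε₁ ε₂ R tensor) (himp : ∀ k, tensor k → tensor' k) :
    IsRun f θ₁ θ₂ σ₀ x₀ ε₁ ε₂ R tensor' :=
  ⟨h.1, h.2.1, fun k hk => (h.2.2 k hk).imp_left (himp k)⟩

lemma IsRun.exists_isStationary {x₀ : E n}
    (h : IsRun f θ₁ θ₂ σ₀ x₀ ε₁ ε₂ R (AccurateTensor f L m R)) (hf : ContDiff ℝ 2 f)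
    (hc : ∀ x, c ≤ f x) (hL : LipschitzWith L (hess f)) (hΔ : f x₀ - c ≤ Δ)
    (hG : ‖gradient f x₀‖ ≤ G) (hσ₀ : 0 < σ₀) (hθ₁ : 0 ≤ θ₁) (hθ₂ : 0 ≤ θ₂) (hm : 1 ≤ m)
    (hε₁ : 0 < ε₁) (hε₂ : 0 < ε₂) :
    ∃ j : ℕ, IsStationary f ε₁ ε₂ (R.x j) ∧ (j : ℝ) ≤ iterBound L Δ G σ₀ θ₁ θ₂ (2 * m) *
      max (ε₁ ^ (-(3 / 2) : ℝ)) (ε₂ ^ (-3 : ℝ)) + 1 := by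
  obtain ⟨rfl, rfl, hiter⟩ := h
  have hbound (K : ℕ) (hns : ∀ j ≤ K, ¬ IsStationary f ε₁ ε₂ (R.x j)) :=
    iterations_le_of_advances (K := K) hf hc hL hΔ hG hσ₀ hθ₁ hθ₂ hm hε₁ hε₂
      (fun k hk => (hiter k fun j hj => hns j (by omega)).1)
      (fun k hk => (hiter k fun j hj => hns j (by omega)).2) (fun k hk => hns _ hk)
  have hnonneg := iterations_le_of_advances (K := 0) (R := R) (L := L) (m := m) hf hc hL hΔ hG hσ₀
    hθ₁ hθ₂ hm hε₁ hε₂ (by simp) (by simp) (by simp)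
  set b := iterBound L Δ G (R.σ 0) θ₁ θ₂ (2 * m) * max (ε₁ ^ (-(3 / 2) : ℝ)) (ε₂ ^ (-3 : ℝ))
  by_contra! hns
  have hfloor : ((⌊b⌋₊ + 1 : ℕ) : ℝ) ≤ b := hbound _ fun j hj hst => (hns j hst).not_ge <| by
    calc (j : ℝ) ≤ (⌊b⌋₊ + 1 : ℕ) := by exact_mod_cast hj
      _ ≤ b + 1 := by
        push_cast
        gcongr
        exact Nat.floor_le (by exact_mod_cast hnonneg)
  exact absurd hfloor (not_le.2 (by exact_mod_cast Nat.lt_floor_add_one b))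

lemma one_le_max_rpow (hε₁ : 0 < ε₁) (hε₂ : 0 < ε₂) (hε : min ε₁ ε₂ ≤ 1) :
    1 ≤ max (ε₁ ^ (-(3 / 2) : ℝ)) (ε₂ ^ (-3 : ℝ)) :=
  le_max_iff.2 <| (min_le_iff.1 hε).imp
    (fun h => Real.one_le_rpow_of_pos_of_le_one_of_nonpos hε₁ h (by norm_num))
    fun h => Real.one_le_rpow_of_pos_of_le_one_of_nonpos hε₂ h (by norm_num)

lemma evalCount_le {queries : ℕ → List (E n)} {q : ℕ} (h : ∀ k, (queries k).length ≤ q) (j : ℕ) :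
    evalCount queries j ≤ q * (j + 1) := by
  simpa [evalCount, mul_comm] using
    Finset.sum_le_card_nsmul (Finset.range (j + 1)) _ q fun k _ => h k

lemma evalCount_le_mul {queries : ℕ → List (E n)} {q j : ℕ} {b X : ℝ}
    (h : ∀ k, (queries k).length ≤ q) (hj : (j : ℝ) ≤ b * X + 1) (hX : 1 ≤ X) :
    (evalCount queries j : ℝ) ≤ q * ((|b| + 2) * X) :=
  calc (evalCount queries j : ℝ) ≤ q * (j + 1) := by exact_mod_cast evalCount_le h j
    _ ≤ q * (|b| * X + 1 * X + 1 * X) := by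
        gcongr
        · exact hj.trans (by gcongr; exacts [le_abs_self b, by linarith])
        · linarith
    _ = q * ((|b| + 2) * X) := by ring

lemma length_lazyGradQueries (R : Sequences n) (k : ℕ) : (lazyGradQueries R k).length = 1 := rfl

lemma length_lazyHessQueries_le (m : ℕ) (R : Sequences n) (k : ℕ) :
    (lazyHessQueries m R k).length ≤ 1 := by
  rw [lazyHessQueries]
  split_ifs <;> simp

lemma length_fdGradQueries_le (m : ℕ) (R : Sequences n) (k : ℕ) :
    (fdGradQueries m R k).length ≤ n + 1 := by
  rw [fdGradQueries]
  split_ifs <;> simp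

end Complexity

end AR2PSB

end

theorem mainTheorem3_general (L : ℝ≥0) (Δ G σ₀ θ₁ θ₂ : ℝ) (m : ℕ)
    (hσ₀ : 0 < σ₀) (hθ₁ : 0 ≤ θ₁) (hθ₂ : 0 ≤ θ₂) (hm : 1 ≤ m) :
    ∃ C : ℝ, 0 < C ∧
      ∀ (n : ℕ), 1 ≤ n →
      ∀ (f : AR2PSB.E n → ℝ) (f_low : ℝ) (x₀ : AR2PSB.E n),
        ContDiff ℝ 2 f →
        (∀ x, f_low ≤ f x) →
        LipschitzWith L (AR2PSB.hess f) →
        f x₀ - f_low ≤ Δ →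
        ‖gradient f x₀‖ ≤ G →
      ∀ (ε₁ ε₂ : ℝ), 0 < ε₁ → 0 < ε₂ → min ε₁ ε₂ ≤ 1 →
        (∀ R : AR2PSB.Sequences n, AR2PSB.IsLazyRun f m θ₁ θ₂ σ₀ x₀ ε₁ ε₂ R →
          ∃ j : ℕ, AR2PSB.IsStationary f ε₁ ε₂ (R.x j) ∧
            (AR2PSB.evalCount (AR2PSB.lazyGradQueries R) j : ℝ) ≤
              C * max (ε₁ ^ (-(3 / 2) : ℝ)) (ε₂ ^ (-3 : ℝ)) ∧
            (AR2PSB.evalCount (AR2PSB.lazyHessQueries m R) j : ℝ) ≤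
              C * max (ε₁ ^ (-(3 / 2) : ℝ)) (ε₂ ^ (-3 : ℝ))) ∧
        (∀ R : AR2PSB.Sequences n, AR2PSB.IsFDRun f m θ₁ θ₂ σ₀ x₀ ε₁ ε₂ R →
          ∃ j : ℕ, AR2PSB.IsStationary f ε₁ ε₂ (R.x j) ∧
            (AR2PSB.evalCount (AR2PSB.fdGradQueries m R) j : ℝ) ≤
              C * (n * max (ε₁ ^ (-(3 / 2) : ℝ)) (ε₂ ^ (-3 : ℝ)))) := by
  set b := AR2PSB.iterBound L Δ G σ₀ θ₁ θ₂ (2 * m)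
  refine ⟨2 * (|b| + 2), by positivity, ?_⟩
  intro n hn f f_low x₀ hf hlow hL hΔ hG ε₁ ε₂ hε₁ hε₂ hε
  have hX := AR2PSB.one_le_max_rpow hε₁ hε₂ hε
  set X := max (ε₁ ^ (-(3 / 2) : ℝ)) (ε₂ ^ (-3 : ℝ))
  refine ⟨fun R hR => ?_, fun R hR => ?_⟩
  · obtain ⟨j, hst, hj⟩ := (hR.mono fun k hk => hk.accurateTensor hf L).exists_isStationary
      hf hlow hL hΔ hG hσ₀ hθ₁ hθ₂ hm hε₁ hε₂
    have hone : ((1 : ℕ) : ℝ) * ((|b| + 2) * X) ≤ 2 * (|b| + 2) * X := by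
      rw [← mul_assoc]
      gcongr
      norm_num
    exact ⟨j, hst,
      (AR2PSB.evalCount_le_mul (fun k => (AR2PSB.length_lazyGradQueries R k).le) hj hX).trans hone,
      (AR2PSB.evalCount_le_mul (AR2PSB.length_lazyHessQueries_le m R) hj hX).trans hone⟩
  · obtain ⟨j, hst, hj⟩ := (hR.mono fun k hk => hk.accurateTensor hf hL hn).exists_isStationary
      hf hlow hL hΔ hG hσ₀ hθ₁ hθ₂ hm hε₁ hε₂
    refine ⟨j, hst, (AR2PSB.evalCount_le_mul (AR2PSB.length_fdGradQueries_le m R) hj hX).trans ?_⟩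
    calc ((n + 1 : ℕ) : ℝ) * ((|b| + 2) * X) ≤ (2 * n : ℕ) * ((|b| + 2) * X) := by
          gcongr
          omega
      _ = 2 * (|b| + 2) * (n * X) := by push_cast; ring

theorem mainTheorem3 (L : ℝ≥0) (Δ G σ₀ θ₁ θ₂ : ℝ) (m : ℕ)
    (hσ₀ : 0 < σ₀) (hθ₁ : 1 < θ₁) (hθ₂ : 1 < θ₂) (hm : 1 ≤ m) :
    ∃ C : ℝ, 0 < C ∧
      ∀ (n : ℕ), 1 ≤ n →
      ∀ (f : AR2PSB.E n → ℝ) (f_low : ℝ) (x₀ : AR2PSB.E n),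
        ContDiff ℝ 2 f →
        (∀ x, f_low ≤ f x) →
        LipschitzWith L (AR2PSB.hess f) →
        f x₀ - f_low ≤ Δ →
        ‖gradient f x₀‖ ≤ G →
      ∀ (ε₁ ε₂ : ℝ), 0 < ε₁ → ε₁ ≤ 1 → 0 < ε₂ → ε₂ ≤ 1 →
        (∀ R : AR2PSB.Sequences n, AR2PSB.IsLazyRun f m θ₁ θ₂ σ₀ x₀ ε₁ ε₂ R →
          ∃ j : ℕ, AR2PSB.IsStationary f ε₁ ε₂ (R.x j) ∧
            (AR2PSB.evalCount (AR2PSB.lazyGradQueries R) j : ℝ) ≤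
              C * max (ε₁ ^ (-(3 / 2) : ℝ)) (ε₂ ^ (-3 : ℝ)) ∧
            (AR2PSB.evalCount (AR2PSB.lazyHessQueries m R) j : ℝ) ≤
              C * max (ε₁ ^ (-(3 / 2) : ℝ)) (ε₂ ^ (-3 : ℝ))) ∧
        (∀ R : AR2PSB.Sequences n, AR2PSB.IsFDRun f m θ₁ θ₂ σ₀ x₀ ε₁ ε₂ R →
          ∃ j : ℕ, AR2PSB.IsStationary f ε₁ ε₂ (R.x j) ∧
            (AR2PSB.evalCount (AR2PSB.fdGradQueries m R) j : ℝ) ≤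
              C * (n * max (ε₁ ^ (-(3 / 2) : ℝ)) (ε₂ ^ (-3 : ℝ)))) := by
  obtain ⟨C, hC, h⟩ :=
    mainTheorem3_general L Δ G σ₀ θ₁ θ₂ m hσ₀ (by linarith) (by linarith) hm
  exact ⟨C, hC, fun n hn f f_low x₀ hf hlow hL hΔ hG ε₁ ε₂ hε₁ hε₁' hε₂ _ =>
    h n hn f f_low x₀ hf hlow hL hΔ hG ε₁ ε₂ hε₁ hε₂ (min_le_of_left_le hε₁')⟩
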